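/- Let $n\ge 1$, let $\mathbb{T}^n=(\mathbb{R}/\mathbb{Z})^n$ with normalized Lebesgue (Haar) measure $\mu$, and let $T(x)=x+\alpha \bmod \mathbb{Z}^n$ be an irrational rotation of $\mathbb{T}^n$, meaning that at least one coordinate of $\alpha\in\mathbb{R}^n$ is irrational (equivalently, $T$ is not of finite order; in particular every ergodic rotation is allowed). Endow the space $C(\mathbb{T}^n,\mathrm{SL}(2,\mathbb{R}))$ of continuous maps $A:\mathbb{T}^n\to\mathrm{SL}(2,\mathbb{R})$ with the topology of uniform convergence, and let $$\mathrm{LE}(A)=\int_{\mathbb{T}^n}\lambda^+(A,x)\,d\mu(x),\qquad \lambda^+(A,x)=\lim_{k\to\infty}\frac1k\log\bigl\|A(T^{k-1}x)\cdots A(Tx)A(x)\bigr\|,$$ where $\|\cdot\|$ is the Euclidean operator norm and the limit exists for $\mu$-almost every $x$ (at the remaining points one may take the upper limit). Then the function $$\mathrm{LE}:C(\mathbb{T}^n,\mathrm{SL}(2,\mathbb{R}))\to\mathbb{R}$$ is discontinuous. -/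

import Mathlib

open MeasureTheory Filter Topology

noncomputable section

/-- The Euclidean operator norm of a real `2 × 2` matrix. -/
def matrixOpNorm (M : Matrix (Fin 2) (Fin 2) ℝ) : ℝ :=
  ‖Matrix.toEuclideanCLM (n := Fin 2) (𝕜 := ℝ) M‖

/-- The iterates `A^n(x) = A(T^{n-1} x) ⋯ A(T x) A(x)`, `n ≥ 0`, of the cocycle `A` over `T`. -/
def cocycleIterate {X : Type*} (T : X → X) (A : X → Matrix.SpecialLinearGroup (Fin 2) ℝ) :
    ℕ → X → Matrix.SpecialLinearGroup (Fin 2) ℝ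
  | 0, _ => 1
  | n + 1, x => A (T^[n] x) * cocycleIterate T A n x

/-- The upper Lyapunov exponent `λ⁺(x) = lim (1/n) log ‖A^n(x)‖`. It is written as an upper limit,
so that it is defined at every point; the upper limit is the limit wherever the limit exists. -/
def upperLyapunovExponent {X : Type*} (T : X → X)
    (A : X → Matrix.SpecialLinearGroup (Fin 2) ℝ) (x : X) : ℝ :=
  limsup (fun n : ℕ =>
    (1 / (n : ℝ)) * Real.log (matrixOpNorm (cocycleIterate T A n x).1)) atTop

/-- The integrated Lyapunov exponent `LE(A) = ∫ λ⁺ dμ` of a continuous cocycle, as a function on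
`C(X, SL(2, ℝ))`. -/
def integratedLyapunovExponent {X : Type*} [TopologicalSpace X] [MeasurableSpace X]
    (T : X → X) (μ : Measure X) (A : C(X, Matrix.SpecialLinearGroup (Fin 2) ℝ)) : ℝ :=
  ∫ x, upperLyapunovExponent T A x ∂μ

/-- The rotation `x ↦ x + α mod ℤ^n` of the torus `(ℝ/ℤ)^n`. -/
def torusRotation {n : ℕ} (α : Fin n → ℝ) (x : UnitAddTorus (Fin n)) : UnitAddTorus (Fin n) :=
  fun i => x i + (α i : UnitAddCircle)

/-- A rotation vector is irrational if it is not rational, that is, if some coordinate is irrational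
(equivalently, no positive power of the rotation is the identity). -/
def IsIrrationalVector {n : ℕ} (α : Fin n → ℝ) : Prop :=
  ∃ i, Irrational (α i)

end

/-!
Precomposition with a coordinate projection `(ℝ/ℤ)^n → ℝ/ℤ` is continuous on cocycles and preserves
the integrated exponent, so it is enough to find a point of discontinuity over the rotation by an
irrational `a` of the circle. Herman's cocycle `A(x) = D * J * R(x)` is such a point, where
`D = diag (exp s, exp (-s))`, `R(x)` is the rotation by the angle `2πx`, `J` is the rotation by a
right angle, and `s` is large.

*The exponent of `A` is large.* Multiplied by suitable powers of `z = exp (2πix)`, the iterates of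
`A` become polynomials in `z`; at `z = 0` the row vector `(i, 1)` is an eigenvector of every factor,
with eigenvalue of modulus `cosh s`. Jensen's formula and the reverse Fatou lemma give
`LE(A) ≥ log (cosh s) ≥ s - log 2`
(`sub_log_two_le_integratedLyapunovExponent`), while `s` is the largest possible value.

*Cocycles near `A` with a smaller exponent.* Since `D * J * D = J`, and rotations commute, the
product of `A` along an orbit segment `-K * a, …, K * a` that is symmetric about `0` telescopes from
the middle outwards to `± J * D⁻¹`: its norm is that of a single factor, however long the segment
(`cocycleIterate_hermanMatrix_symmetric`). There are arbitrarily large `H` for which the first `H`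
points of an orbit are `1 / (2 * H)`-separated (`exists_forall_one_div_two_mul_le_norm_nsmul`). With
`2 * K + 1 ≤ H`, disjoint balls of radius comparable to `1 / H` about the points of the symmetric
segment fill a fixed proportion of the circle, and a map `φ` close to the identity collapses each of
them to its centre. For `A ∘ φ`, every passage through this tower of balls contributes a single
factor in place of `2 * K + 1` (`logGrowth_le_sub_visits`). By Weyl's equidistribution theorem every
orbit spends a fixed proportion of its time in the tower, whence `LE(A ∘ φ) ≤ 15 / 16 * s`
(`exists_dist_le_and_integratedLyapunovExponent_le`). As `φ` tends to the identity, `A ∘ φ` tends to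
`A`, but for `s = 16` the exponents stay below `15 < 16 - log 2`.
-/

namespace LyapunovRotation

/-! ### Operator norms and growth of cocycles -/

lemma matrixOpNorm_nonneg (M : Matrix (Fin 2) (Fin 2) ℝ) : 0 ≤ matrixOpNorm M :=
  norm_nonneg _

lemma matrixOpNorm_mul_le (M N : Matrix (Fin 2) (Fin 2) ℝ) :
    matrixOpNorm (M * N) ≤ matrixOpNorm M * matrixOpNorm N := by
  unfold matrixOpNorm
  rw [map_mul]
  exact norm_mul_le _ _

lemma matrixOpNorm_one : matrixOpNorm 1 = 1 := by
  unfold matrixOpNorm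
  rw [map_one]
  exact norm_one

lemma matrixOpNorm_le {M : Matrix (Fin 2) (Fin 2) ℝ} {C : ℝ} (hC : 0 ≤ C)
    (h : ∀ x y : ℝ, (M 0 0 * x + M 0 1 * y) ^ 2 + (M 1 0 * x + M 1 1 * y) ^ 2
      ≤ C ^ 2 * (x ^ 2 + y ^ 2)) :
    matrixOpNorm M ≤ C := by
  refine ContinuousLinearMap.opNorm_le_bound _ hC fun v => ?_
  refine abs_le_of_sq_le_sq' ?_ (by positivity) |>.2
  rw [mul_pow, EuclideanSpace.norm_sq_eq, EuclideanSpace.norm_sq_eq]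
  simpa [Matrix.mulVec, dotProduct, Fin.sum_univ_two] using h (v 0) (v 1)

lemma sq_add_sq_le_matrixOpNorm_sq (M : Matrix (Fin 2) (Fin 2) ℝ) (j : Fin 2) :
    M 0 j ^ 2 + M 1 j ^ 2 ≤ matrixOpNorm M ^ 2 := by
  have h := (Matrix.toEuclideanCLM (n := Fin 2) (𝕜 := ℝ) M).le_opNorm (EuclideanSpace.single j 1)
  have h2 := pow_le_pow_left₀ (norm_nonneg _) h 2
  rw [mul_pow, EuclideanSpace.norm_sq_eq, PiLp.norm_single] at h2
  simpa [Matrix.mulVec, dotProduct, Fin.sum_univ_two, matrixOpNorm] using h2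

lemma abs_entry_le_matrixOpNorm (M : Matrix (Fin 2) (Fin 2) ℝ) (i j : Fin 2) :
    |M i j| ≤ matrixOpNorm M := by
  refine abs_le_of_sq_le_sq ?_ (matrixOpNorm_nonneg M)
  have h := sq_add_sq_le_matrixOpNorm_sq M j
  fin_cases i
  · simpa using (le_add_of_nonneg_right (sq_nonneg (M 1 j))).trans h
  · simpa using (le_add_of_nonneg_left (sq_nonneg (M 0 j))).trans h

/-- Hadamard's inequality bounds the determinant by the square of the norm. -/
lemma one_le_matrixOpNorm (M : Matrix.SpecialLinearGroup (Fin 2) ℝ) :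
    1 ≤ matrixOpNorm M.1 := by
  have h0 := sq_add_sq_le_matrixOpNorm_sq M.1 0
  have h1 := sq_add_sq_le_matrixOpNorm_sq M.1 1
  have hd := M.2
  rw [Matrix.det_fin_two] at hd
  set a := M.1 0 0
  set b := M.1 0 1
  set c := M.1 1 0
  set d := M.1 1 1
  have h : (a ^ 2 + c ^ 2) * (b ^ 2 + d ^ 2) = 1 + (a * b + c * d) ^ 2 := by
    linear_combination (a * d - b * c + 1) * hd
  have h2 : (1 : ℝ) ≤ (matrixOpNorm M.1 ^ 2) ^ 2 := by
    have := mul_le_mul h0 h1 (by positivity) (by positivity)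
    nlinarith [sq_nonneg (a * b + c * d)]
  rw [← pow_mul] at h2
  exact (one_le_pow_iff_of_nonneg (matrixOpNorm_nonneg _) (by norm_num)).1 h2

lemma continuous_matrixOpNorm : Continuous matrixOpNorm := by
  have : Continuous fun M : Matrix (Fin 2) (Fin 2) ℝ =>
      Matrix.toEuclideanCLM (n := Fin 2) (𝕜 := ℝ) M :=
    LinearMap.continuous_of_finiteDimensional
      (Matrix.toEuclideanCLM (n := Fin 2) (𝕜 := ℝ)).toAlgEquiv.toLinearMap
  exact this.norm

section Cocycle

variable {X : Type*} (T : X → X) (A : X → Matrix.SpecialLinearGroup (Fin 2) ℝ)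

lemma cocycleIterate_add (m n : ℕ) (x : X) :
    cocycleIterate T A (m + n) x = cocycleIterate T A m (T^[n] x) * cocycleIterate T A n x := by
  induction m with
  | zero => simp [cocycleIterate]
  | succ m ih =>
    rw [Nat.add_right_comm]
    simp only [cocycleIterate]
    rw [ih, ← mul_assoc, Function.iterate_add_apply]

/-- The logarithm of the norm of the `n`-th iterate. -/
noncomputable def logGrowth (n : ℕ) (x : X) : ℝ :=
  Real.log (matrixOpNorm (cocycleIterate T A n x).1)

lemma logGrowth_nonneg (n : ℕ) (x : X) : 0 ≤ logGrowth T A n x :=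
  Real.log_nonneg (one_le_matrixOpNorm _)

lemma logGrowth_add_le (m n : ℕ) (x : X) :
    logGrowth T A (m + n) x ≤ logGrowth T A m (T^[n] x) + logGrowth T A n x := by
  unfold logGrowth
  have h1 := one_le_matrixOpNorm (cocycleIterate T A m (T^[n] x))
  have h2 := one_le_matrixOpNorm (cocycleIterate T A n x)
  have h3 := one_le_matrixOpNorm (cocycleIterate T A (m + n) x)
  rw [← Real.log_mul (by positivity) (by positivity)]
  refine Real.log_le_log (by positivity) ?_
  rw [cocycleIterate_add]
  exact matrixOpNorm_mul_le _ _

lemma logGrowth_le {Λ : ℝ} (hΛ : ∀ x, Real.log (matrixOpNorm (A x).1) ≤ Λ) (n : ℕ) (x : X) :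
    logGrowth T A n x ≤ n * Λ := by
  induction n with
  | zero => simp [logGrowth, cocycleIterate, matrixOpNorm_one]
  | succ n ih =>
    have h := logGrowth_add_le T A 1 n x
    have h1 : logGrowth T A 1 (T^[n] x) ≤ Λ := by
      simpa [logGrowth, cocycleIterate] using hΛ (T^[n] x)
    rw [add_comm 1 n] at h
    push_cast
    linarith

/-- If `f` is a bump on a set whose first `H - 1` images avoid it, and a stretch of `H` steps
that begins in that set costs no more than a single step, then every visit saves `H - 1` steps.
The additive term `H` pays for a last stretch that is cut short. -/
lemma logGrowth_le_sub_visits {Λ : ℝ} (hΛ : ∀ x, Real.log (matrixOpNorm (A x).1) ≤ Λ)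
    {f : X → ℝ} (hf : ∀ x, f x ≤ 1) {H : ℕ} (hH : 0 < H)
    (hdisj : ∀ x, f x ≠ 0 → ∀ i, 0 < i → i < H → f (T^[i] x) = 0)
    (hcheap : ∀ x, f x ≠ 0 → logGrowth T A H x ≤ Λ) (n : ℕ) (x : X) :
    logGrowth T A n x ≤ Λ * (n + H - (H - 1) * ∑ i ∈ Finset.range n, f (T^[i] x)) := by
  have hΛ0 : 0 ≤ Λ := (Real.log_nonneg (one_le_matrixOpNorm _)).trans (hΛ x)
  have hH1 : (1 : ℝ) ≤ H := by exact_mod_cast hH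
  -- Along a stretch that begins in the support of `f`, only the first term of the sum survives.
  have hsum : ∀ y, f y ≠ 0 → ∀ m, m ≤ H → ∑ i ∈ Finset.range m, f (T^[i] y) ≤ 1 := by
    intro y hy m hm
    rcases m with _ | m
    · simp
    · rw [Finset.sum_range_succ', Finset.sum_eq_zero]
      · simpa using hf y
      · intro i hi
        exact hdisj y hy _ (Nat.succ_pos i) (by have := Finset.mem_range.1 hi; omega)
  induction n using Nat.strong_induction_on generalizing x with
  | _ n ih =>
    by_cases hx : f x = 0
    · rcases n with _ | n
      · have := logGrowth_le T A hΛ 0 x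
        simp at this ⊢
        nlinarith
      · have h := logGrowth_add_le T A n 1 x
        have h1 : logGrowth T A 1 x ≤ Λ := by
          simpa [logGrowth, cocycleIterate] using hΛ x
        have h2 := ih n (Nat.lt_succ_self n) (T x)
        rw [Finset.sum_range_succ']
        simp only [Function.iterate_succ_apply, Function.iterate_zero, id, hx] at h ⊢
        push_cast
        linarith
    · rcases lt_or_ge n H with hn | hn
      · have h := logGrowth_le T A hΛ n x
        have h1 := hsum x hx n hn.le
        have h2 : (H - 1 : ℝ) * ∑ i ∈ Finset.range n, f (T^[i] x) ≤ H - 1 := by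
          nlinarith
        nlinarith
      · obtain ⟨m, rfl⟩ := Nat.exists_eq_add_of_le' hn
        have h := logGrowth_add_le T A m H x
        have h2 := ih m (by omega) (T^[H] x)
        have h3 := hcheap x hx
        have h1 := hsum x hx H le_rfl
        have h4 : ∑ i ∈ Finset.range (m + H), f (T^[i] x) =
            ∑ i ∈ Finset.range H, f (T^[i] x) + ∑ i ∈ Finset.range m, f (T^[i] (T^[H] x)) := by
          rw [add_comm m H, Finset.sum_range_add]
          simp only [← Function.iterate_add_apply, add_comm]
        rw [h4]
        push_cast
        have h5 : (H - 1 : ℝ) * ∑ i ∈ Finset.range H, f (T^[i] x) ≤ H - 1 := by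
          nlinarith
        nlinarith

lemma upperLyapunovExponent_eq (x : X) : upperLyapunovExponent T A x =
    limsup (fun n : ℕ => (1 / (n : ℝ)) * logGrowth T A n x) atTop := rfl

lemma one_div_mul_logGrowth_nonneg (n : ℕ) (x : X) : 0 ≤ (1 / (n : ℝ)) * logGrowth T A n x :=
  mul_nonneg (by positivity) (logGrowth_nonneg T A n x)

lemma one_div_mul_logGrowth_le {Λ : ℝ} (hΛ : ∀ x, Real.log (matrixOpNorm (A x).1) ≤ Λ)
    (n : ℕ) (x : X) : (1 / (n : ℝ)) * logGrowth T A n x ≤ Λ := by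
  have hΛ0 : 0 ≤ Λ := (Real.log_nonneg (one_le_matrixOpNorm _)).trans (hΛ x)
  rcases Nat.eq_zero_or_pos n with rfl | hn
  · simpa using hΛ0
  · rw [one_div, inv_mul_le_iff₀ (by exact_mod_cast hn)]
    exact logGrowth_le T A hΛ n x

lemma upperLyapunovExponent_nonneg {Λ : ℝ} (hΛ : ∀ x, Real.log (matrixOpNorm (A x).1) ≤ Λ)
    (x : X) : 0 ≤ upperLyapunovExponent T A x := by
  rw [upperLyapunovExponent_eq]
  exact le_limsup_of_frequently_le
    (Frequently.of_forall fun n => one_div_mul_logGrowth_nonneg T A n x)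
    (isBoundedUnder_of ⟨Λ, fun n => one_div_mul_logGrowth_le T A hΛ n x⟩)

lemma upperLyapunovExponent_le_of_tendsto {u : ℕ → ℝ} {c : ℝ} {x : X}
    (h : ∀ n : ℕ, 0 < n → (1 / (n : ℝ)) * logGrowth T A n x ≤ u n) (hu : Tendsto u atTop (𝓝 c)) :
    upperLyapunovExponent T A x ≤ c := by
  rw [upperLyapunovExponent_eq, ← hu.limsup_eq]
  refine limsup_le_limsup ?_ ?_ hu.isBoundedUnder_le
  · filter_upwards [eventually_gt_atTop 0] with n hn using h n hn
  · exact isCoboundedUnder_le_of_le atTop (fun n => one_div_mul_logGrowth_nonneg T A n x)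

end Cocycle

/-! ### Separation of the orbits of an irrational rotation -/

lemma natCast_mul_coe_unitAddCircle (j : ℕ) (a : ℝ) :
    ((j * a : ℝ) : UnitAddCircle) = j • (a : UnitAddCircle) := by
  rw [← nsmul_eq_mul, AddCircle.coe_nsmul]

lemma norm_nsmul_eq_abs_sub_round (j : ℕ) (a : ℝ) :
    ‖j • (a : UnitAddCircle)‖ = |j * a - round (j * a)| := by
  rw [← natCast_mul_coe_unitAddCircle, UnitAddCircle.norm_eq]

lemma norm_nsmul_pos {a : ℝ} (ha : Irrational a) {j : ℕ} (hj : 0 < j) :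
    0 < ‖j • (a : UnitAddCircle)‖ := by
  rw [norm_nsmul_eq_abs_sub_round, abs_pos, sub_ne_zero]
  exact (ha.natCast_mul hj.ne').ne_int _

/-- If `H` is a time of record proximity to `0`, then no earlier time comes closer than
`1 / (2 * H)`: for the best earlier time `N`, the integers nearest to `N * a` and `H * a` have a
nonzero determinant with `N` and `H`. -/
lemma one_div_two_mul_le_norm_nsmul {a : ℝ} {H : ℕ}
    (hrec : ∀ j : ℕ, 0 < j → j < H → ‖H • (a : UnitAddCircle)‖ < ‖j • (a : UnitAddCircle)‖)
    {N : ℕ} (hN : 0 < N) (hNH : N < H) : 1 / (2 * (H : ℝ)) ≤ ‖N • (a : UnitAddCircle)‖ := by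
  have hlt := hrec N hN hNH
  simp only [norm_nsmul_eq_abs_sub_round] at hlt ⊢
  set p := round (N * a)
  set q := round (H * a)
  have hN' : (0 : ℝ) < N := by exact_mod_cast hN
  have hH' : (0 : ℝ) < H := by exact_mod_cast hN.trans hNH
  have hNH' : (N : ℝ) < H := by exact_mod_cast hNH
  have hid : ((N * q - H * p : ℤ) : ℝ) = H * (N * a - p) - N * (H * a - q) := by
    push_cast; ring
  have h1 : (1 : ℝ) ≤ |((N * q - H * p : ℤ) : ℝ)| := by
    rw [← Int.cast_abs]
    norm_cast
    refine Int.one_le_abs fun h0 => ?_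
    rw [h0, Int.cast_zero, eq_comm, sub_eq_zero] at hid
    have h2 := congrArg abs hid
    rw [abs_mul, abs_mul, abs_of_pos hH', abs_of_pos hN'] at h2
    have := abs_nonneg (H * a - q)
    nlinarith
  rw [hid] at h1
  have h3 := h1.trans (abs_sub _ _)
  rw [abs_mul, abs_mul, abs_of_pos hH', abs_of_pos hN'] at h3
  rw [div_le_iff₀ (by positivity)]
  have := abs_nonneg (H * a - q)
  nlinarith

/-- There are arbitrarily large `H` for which the first `H` multiples of an irrational rotation
are nearly as well separated as `H` points on the circle can be. -/
lemma exists_forall_one_div_two_mul_le_norm_nsmul {a : ℝ} (ha : Irrational a) (M : ℕ) :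
    ∃ H : ℕ, M ≤ H ∧ ∀ j : ℕ, 0 < j → j < H → 1 / (2 * (H : ℝ)) ≤ ‖j • (a : UnitAddCircle)‖ := by
  classical
  obtain ⟨ε, hε, hεM⟩ : ∃ ε : ℝ, 0 < ε ∧
      ∀ j : ℕ, 0 < j → j < M → ε ≤ ‖j • (a : UnitAddCircle)‖ := by
    induction M with
    | zero => exact ⟨1, one_pos, fun j _ h => absurd h (Nat.not_lt_zero _)⟩
    | succ M ih =>
      obtain ⟨ε, hε, h⟩ := ih
      rcases Nat.eq_zero_or_pos M with rfl | hM
      · exact ⟨ε, hε, fun j h0 h1 => absurd h1 (by omega)⟩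
      · refine ⟨min ε ‖M • (a : UnitAddCircle)‖, lt_min hε (norm_nsmul_pos ha hM), ?_⟩
        intro j h0 h1
        rcases Nat.lt_succ_iff_lt_or_eq.1 h1 with h2 | rfl
        · exact (min_le_left _ _).trans (h j h0 h2)
        · exact min_le_right _ _
  have hex : ∃ j : ℕ, 0 < j ∧ ‖j • (a : UnitAddCircle)‖ < ε := by
    obtain ⟨n, hn⟩ := exists_nat_one_div_lt hε
    obtain ⟨k, hk0, -, hk⟩ := Real.exists_nat_abs_mul_sub_round_le a (Nat.succ_pos n)
    refine ⟨k, hk0, ?_⟩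
    rw [norm_nsmul_eq_abs_sub_round]
    refine hk.trans_lt (lt_of_le_of_lt ?_ hn)
    push_cast
    gcongr
    linarith
  have hspec := Nat.find_spec hex
  refine ⟨Nat.find hex, ?_, fun j h0 hj => one_div_two_mul_le_norm_nsmul (fun i hi0 hi => ?_) h0 hj⟩
  · by_contra! hlt
    exact absurd (hεM _ hspec.1 hlt) (not_le.2 hspec.2)
  · have := Nat.find_min hex hi
    push Not at this
    exact hspec.2.trans_le (this hi0)

/-! ### Equidistribution -/

lemma iterate_add_right_apply {G : Type*} [AddMonoid G] (a x : G) (n : ℕ) :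
    (fun y => y + a)^[n] x = x + n • a := by
  rw [add_right_iterate]

lemma fourier_coe_ne_one {a : ℝ} (ha : Irrational a) {k : ℤ} (hk : k ≠ 0) :
    fourier k (a : UnitAddCircle) ≠ 1 := by
  intro h
  rw [fourier_apply] at h
  have h1 : AddCircle.toCircle (k • (a : UnitAddCircle)) =
      AddCircle.toCircle (0 : UnitAddCircle) := by
    rw [AddCircle.toCircle_zero]
    exact Circle.ext (by rw [h, Circle.coe_one])
  have h2 := AddCircle.injective_toCircle one_ne_zero h1
  rw [← AddCircle.coe_zsmul, AddCircle.coe_eq_zero_iff] at h2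
  obtain ⟨n, hn⟩ := h2
  simp only [zsmul_eq_mul, mul_one] at hn
  exact (ha.intCast_mul hk).ne_int n hn.symm

lemma tendsto_average_fourier {a : ℝ} (ha : Irrational a) (k : ℤ) (x : UnitAddCircle) :
    Tendsto (fun n : ℕ => (n : ℂ)⁻¹ * ∑ i ∈ Finset.range n, fourier k (x + i • (a : UnitAddCircle)))
      atTop (𝓝 (∫ y : UnitAddCircle, fourier k y)) := by
  rcases eq_or_ne k 0 with rfl | hk
  · refine tendsto_const_nhds.congr' ?_
    filter_upwards [eventually_gt_atTop 0] with n hn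
    have : (n : ℂ) ≠ 0 := by exact_mod_cast hn.ne'
    simp [this, measureReal_def]
  · set ω := fourier k (a : UnitAddCircle) with hω
    have hω1 : ω ≠ 1 := fourier_coe_ne_one ha hk
    have hadd : ∀ y z : UnitAddCircle, fourier k (y + z) = fourier k y * fourier k z := by
      intro y z
      simp [fourier_apply, smul_add, AddCircle.toCircle_add]
    have hint : ∫ y : UnitAddCircle, fourier k y = 0 := by
      have h := integral_add_right_eq_self (μ := (volume : Measure UnitAddCircle))
        (fun y : UnitAddCircle => (fourier k y : ℂ)) (a : UnitAddCircle)
      simp only [hadd] at h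
      rw [integral_mul_const] at h
      have h2 : (∫ y : UnitAddCircle, fourier k y) * (ω - 1) = 0 := by
        rw [mul_sub, h]; ring
      exact (mul_eq_zero.1 h2).resolve_right (sub_ne_zero.2 hω1)
    have hn : ∀ i : ℕ, fourier k (i • (a : UnitAddCircle)) = ω ^ i := by
      intro i
      induction i with
      | zero => simp
      | succ i ih => rw [succ_nsmul, hadd, ih, pow_succ]
    rw [hint]
    have hb : ∀ n : ℕ, ‖(n : ℂ)⁻¹ * ∑ i ∈ Finset.range n, fourier k (x + i • (a : UnitAddCircle))‖
        ≤ (n : ℝ)⁻¹ * (2 / ‖ω - 1‖) := by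
      intro n
      simp only [hadd, hn]
      have hωn : ‖ω‖ = 1 := by rw [hω, fourier_apply]; exact Circle.norm_coe _
      have hx : ‖(fourier k x : ℂ)‖ = 1 := by rw [fourier_apply]; exact Circle.norm_coe _
      rw [← Finset.mul_sum, geom_sum_eq hω1, norm_mul, norm_mul, hx, one_mul, norm_inv,
        Complex.norm_natCast, norm_div]
      gcongr
      refine (norm_sub_le _ _).trans ?_
      rw [norm_pow, hωn]
      norm_num
    refine squeeze_zero_norm hb ?_
    simpa using tendsto_inv_atTop_nhds_zero_nat.mul_const (2 / ‖ω - 1‖)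

lemma norm_average_sub_le {X : Type*} [TopologicalSpace X] [CompactSpace X] (f g : C(X, ℂ))
    (s : ℕ → X) (n : ℕ) :
    ‖(n : ℂ)⁻¹ * ∑ i ∈ Finset.range n, f (s i) - (n : ℂ)⁻¹ * ∑ i ∈ Finset.range n, g (s i)‖
      ≤ ‖f - g‖ := by
  rw [← mul_sub, ← Finset.sum_sub_distrib, norm_mul, norm_inv, Complex.norm_natCast]
  rcases Nat.eq_zero_or_pos n with rfl | hn
  · simp
  · rw [inv_mul_le_iff₀ (by exact_mod_cast hn)]
    refine (norm_sum_le _ _).trans ?_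
    refine (Finset.sum_le_card_nsmul _ _ ‖f - g‖ fun i _ => ?_).trans (by simp)
    exact (f - g).norm_coe_le_norm (s i)

/-- **Weyl's equidistribution theorem** for an irrational rotation of the circle. -/
theorem tendsto_average_of_irrational {a : ℝ} (ha : Irrational a) (f : C(UnitAddCircle, ℂ))
    (x : UnitAddCircle) :
    Tendsto (fun n : ℕ => (n : ℂ)⁻¹ * ∑ i ∈ Finset.range n, f (x + i • (a : UnitAddCircle)))
      atTop (𝓝 (∫ y : UnitAddCircle, f y)) := by
  have hi : ∀ g : C(UnitAddCircle, ℂ), Integrable (fun y => g y) :=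
    fun g => g.continuous.integrable_of_hasCompactSupport (HasCompactSupport.of_compactSpace _)
  have hspan : ∀ g ∈ Submodule.span ℂ (Set.range (fourier (T := 1))),
      Tendsto (fun n : ℕ => (n : ℂ)⁻¹ * ∑ i ∈ Finset.range n, g (x + i • (a : UnitAddCircle)))
      atTop (𝓝 (∫ y : UnitAddCircle, g y)) := by
    intro g hg
    induction hg using Submodule.span_induction with
    | mem g hg =>
      obtain ⟨k, rfl⟩ := hg
      exact tendsto_average_fourier ha k x
    | zero => simp
    | add g h _ _ ihg ihh =>
      simp only [ContinuousMap.add_apply, Finset.sum_add_distrib, mul_add]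
      rw [integral_add (hi g) (hi h)]
      exact ihg.add ihh
    | smul c g _ ih =>
      simp only [ContinuousMap.smul_apply, ← Finset.smul_sum, mul_smul_comm]
      rw [integral_smul]
      exact ih.const_smul c
  have hf : f ∈ closure (Submodule.span ℂ (Set.range (fourier (T := 1))) :
      Set C(UnitAddCircle, ℂ)) := by
    have := span_fourier_closure_eq_top (T := 1)
    rw [← Submodule.topologicalClosure_coe, this]
    trivial
  rw [Metric.tendsto_atTop]
  intro ε hε
  obtain ⟨g, hg, hfg⟩ := Metric.mem_closure_iff.1 hf (ε / 3) (by positivity)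
  rw [dist_eq_norm] at hfg
  obtain ⟨N, hN⟩ := Metric.tendsto_atTop.1 (hspan g hg) (ε / 3) (by positivity)
  refine ⟨N, fun n hn => ?_⟩
  have h1 := norm_average_sub_le f g (fun i => x + i • (a : UnitAddCircle)) n
  have h2 := hN n hn
  have h3 : ‖(∫ y : UnitAddCircle, g y) - ∫ y : UnitAddCircle, f y‖ ≤ ‖f - g‖ := by
    rw [← integral_sub (hi g) (hi f)]
    refine (norm_integral_le_of_norm_le_const (C := ‖f - g‖) (ae_of_all _ fun y => ?_)).trans ?_
    · rw [← norm_sub_rev]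
      exact (f - g).norm_coe_le_norm y
    · simp [measureReal_def]
  rw [dist_eq_norm] at h2 ⊢
  have h4 := norm_sub_le_norm_sub_add_norm_sub
    ((n : ℂ)⁻¹ * ∑ i ∈ Finset.range n, f (x + i • (a : UnitAddCircle)))
    ((n : ℂ)⁻¹ * ∑ i ∈ Finset.range n, g (x + i • (a : UnitAddCircle))) (∫ y, f y)
  have h5 := norm_sub_le_norm_sub_add_norm_sub
    ((n : ℂ)⁻¹ * ∑ i ∈ Finset.range n, g (x + i • (a : UnitAddCircle))) (∫ y, g y) (∫ y, f y)
  linarith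

lemma tendsto_real_average_of_irrational {a : ℝ} (ha : Irrational a) (f : C(UnitAddCircle, ℝ))
    (x : UnitAddCircle) :
    Tendsto (fun n : ℕ => (1 / (n : ℝ)) * ∑ i ∈ Finset.range n, f (x + i • (a : UnitAddCircle)))
      atTop (𝓝 (∫ y : UnitAddCircle, f y)) := by
  have h := tendsto_average_of_irrational ha
    ⟨fun y => (f y : ℂ), Complex.continuous_ofReal.comp f.continuous⟩ x
  simp only [ContinuousMap.coe_mk] at h
  rw [integral_complex_ofReal] at h
  have h2 := (Complex.continuous_re.tendsto _).comp h
  rw [Complex.ofReal_re] at h2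
  refine h2.congr fun n => ?_
  simp only [Function.comp]
  rw [← Complex.ofReal_sum, ← Complex.ofReal_natCast, ← Complex.ofReal_inv, ← Complex.ofReal_mul,
    Complex.ofReal_re, one_div]

/-! ### Herman's cocycle and its lower bound -/

lemma re_sq_add_im_sq (z : Circle) : (z : ℂ).re ^ 2 + (z : ℂ).im ^ 2 = 1 := by
  have h := Circle.normSq_coe z
  rw [Complex.normSq_apply] at h
  linarith

/-- The matrix `diag (exp s, exp (-s))` times the rotation that takes `1` to `i * z`. -/
noncomputable def hermanMatrix (s : ℝ) (z : Circle) : Matrix.SpecialLinearGroup (Fin 2) ℝ :=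
  ⟨!![-(Real.exp s * (z : ℂ).im), -(Real.exp s * (z : ℂ).re);
      Real.exp (-s) * (z : ℂ).re, -(Real.exp (-s) * (z : ℂ).im)], by
    have h := re_sq_add_im_sq z
    have h2 : Real.exp s * Real.exp (-s) = 1 := by rw [← Real.exp_add]; simp
    rw [Matrix.det_fin_two_of]
    linear_combination (Real.exp s * Real.exp (-s)) * h + h2⟩

lemma continuous_hermanMatrix (s : ℝ) : Continuous (hermanMatrix s) := by
  have hre : Continuous fun z : Circle => (z : ℂ).re := 
    Complex.continuous_re.comp continuous_subtype_val
  have him : Continuous fun z : Circle => (z : ℂ).im := 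
    Complex.continuous_im.comp continuous_subtype_val
  refine Continuous.subtype_mk (continuous_matrix fun i j => ?_) _
  fin_cases i <;> fin_cases j <;> simp <;> fun_prop

/-- Herman's cocycle `x ↦ hermanMatrix s (exp (2πix))` over the circle. -/
noncomputable def hermanCocycle (s : ℝ) :
    C(UnitAddCircle, Matrix.SpecialLinearGroup (Fin 2) ℝ) :=
  ⟨fun x => hermanMatrix s (AddCircle.toCircle x),
    (continuous_hermanMatrix s).comp AddCircle.continuous_toCircle⟩

lemma matrixOpNorm_hermanMatrix_le {s : ℝ} (hs : 0 ≤ s) (z : Circle) :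
    matrixOpNorm (hermanMatrix s z).1 ≤ Real.exp s := by
  refine matrixOpNorm_le (Real.exp_pos s).le fun x y => ?_
  have h := re_sq_add_im_sq z
  have h2 : Real.exp (-s) ^ 2 ≤ Real.exp s ^ 2 :=
    pow_le_pow_left₀ (Real.exp_pos _).le (Real.exp_le_exp.2 (by linarith)) 2
  simp only [hermanMatrix, Matrix.of_apply, Matrix.cons_val', Matrix.cons_val_zero,
    Matrix.cons_val_one, Matrix.cons_val_fin_one]
  set p := (z : ℂ).re
  set q := (z : ℂ).im
  have h3 : x ^ 2 + y ^ 2 = (q * x + p * y) ^ 2 + (p * x - q * y) ^ 2 := by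
    linear_combination (-(x ^ 2) - y ^ 2) * h
  rw [h3]
  nlinarith [mul_le_mul_of_nonneg_right h2 (sq_nonneg (p * x - q * y))]

lemma log_matrixOpNorm_hermanMatrix_le {s : ℝ} (hs : 0 ≤ s) (z : Circle) :
    Real.log (matrixOpNorm (hermanMatrix s z).1) ≤ s := by
  have h1 := one_le_matrixOpNorm (hermanMatrix s z)
  rw [Real.log_le_iff_le_exp (by positivity)]
  exact matrixOpNorm_hermanMatrix_le hs z

/-- The matrix `z • hermanMatrix s (c * z)` for `z` on the unit circle, extended to a polynomial
in `z`. -/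
noncomputable def hermanFactor (s : ℝ) (c : Circle) (z : ℂ) : Matrix (Fin 2) (Fin 2) ℂ :=
  !![-(Real.exp s * ((c * z ^ 2 - (c⁻¹ : Circle)) / (2 * Complex.I))),
      -(Real.exp s * ((c * z ^ 2 + (c⁻¹ : Circle)) / 2));
      Real.exp (-s) * ((c * z ^ 2 + (c⁻¹ : Circle)) / 2),
      -(Real.exp (-s) * ((c * z ^ 2 - (c⁻¹ : Circle)) / (2 * Complex.I)))]

lemma hermanFactor_coe (s : ℝ) (c z : Circle) :
    hermanFactor s c z = (z : ℂ) • (hermanMatrix s (c * z)).1.map Complex.ofReal := by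
  have hz : (z : ℂ) * (z⁻¹ : Circle) = 1 := by rw [← Circle.coe_mul]; simp
  have hre : (((c * z : Circle) : ℂ).re : ℂ) = (c * z + (c⁻¹ : Circle) * (z⁻¹ : Circle)) / 2 := by
    rw [Complex.re_eq_add_conj, ← Circle.coe_inv_eq_conj, mul_inv, Circle.coe_mul, Circle.coe_mul]
  have him : (((c * z : Circle) : ℂ).im : ℂ)
      = (c * z - (c⁻¹ : Circle) * (z⁻¹ : Circle)) / (2 * Complex.I) := by
    rw [Complex.im_eq_sub_conj, ← Circle.coe_inv_eq_conj, mul_inv, Circle.coe_mul, Circle.coe_mul]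
  have h1 : (z : ℂ) * (((c * z : Circle) : ℂ).re : ℂ) = (c * z ^ 2 + (c⁻¹ : Circle)) / 2 := by
    rw [hre]; linear_combination ((c⁻¹ : Circle) : ℂ) / 2 * hz
  have h2 : (z : ℂ) * (((c * z : Circle) : ℂ).im : ℂ)
      = (c * z ^ 2 - (c⁻¹ : Circle)) / (2 * Complex.I) := by
    rw [him]; linear_combination (-((c⁻¹ : Circle) : ℂ) / (2 * Complex.I)) * hz
  ext i j
  fin_cases i <;> fin_cases j <;>
    simp only [hermanFactor, hermanMatrix, ← h1, ← h2, Matrix.smul_apply, Matrix.map_apply,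
      Matrix.of_apply, Matrix.cons_val', Matrix.cons_val_zero, Matrix.cons_val_one,
      Matrix.cons_val_fin_one, Complex.ofReal_neg, Complex.ofReal_mul, smul_eq_mul,
      Fin.zero_eta, Fin.mk_one, Fin.isValue] <;> ring

/-- The product of the polynomial factors along the sequence `c`. -/
noncomputable def hermanProd (s : ℝ) (c : ℕ → Circle) : ℕ → ℂ → Matrix (Fin 2) (Fin 2) ℂ
  | 0, _ => 1
  | n + 1, z => hermanFactor s (c n) z * hermanProd s c n z

lemma hermanProd_toCircle (s a : ℝ) (n : ℕ) (x : UnitAddCircle) :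
    hermanProd s (fun n => AddCircle.toCircle (n • (a : UnitAddCircle))) n (AddCircle.toCircle x) =
      (AddCircle.toCircle x : ℂ) ^ n •
        (cocycleIterate (· + (a : UnitAddCircle)) (hermanCocycle s) n x).1.map Complex.ofReal := by
  induction n with
  | zero =>
    simp only [hermanProd, cocycleIterate, pow_zero, one_smul, Matrix.SpecialLinearGroup.coe_one]
    exact (Matrix.map_one _ Complex.ofReal_zero Complex.ofReal_one).symm
  | succ n ih =>
    simp only [hermanProd, cocycleIterate]
    rw [ih, hermanFactor_coe, iterate_add_right_apply, Matrix.SpecialLinearGroup.coe_mul,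
      smul_mul_smul_comm, pow_succ', ← AddCircle.toCircle_add, add_comm _ x]
    congr 1
    exact (Matrix.map_mul (f := Complex.ofRealHom)).symm

lemma differentiable_hermanProd (s : ℝ) (c : ℕ → Circle) (n : ℕ) (i j : Fin 2) :
    Differentiable ℂ fun z => hermanProd s c n z i j := by
  have hF : ∀ c : Circle, ∀ i j : Fin 2, Differentiable ℂ fun z => hermanFactor s c z i j := by
    intro c i j
    fin_cases i <;> fin_cases j <;> simp [hermanFactor] <;> fun_prop
  induction n generalizing i j with
  | zero => simp [hermanProd]
  | succ n ih =>
    simp only [hermanProd, Matrix.mul_apply, Fin.sum_univ_two]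
    exact ((hF _ _ _).mul (ih _ _)).add ((hF _ _ _).mul (ih _ _))

/-- The row vector `(i, 1)` is an eigenvector of every factor at `z = 0`. -/
lemma norm_vecMul_hermanProd_zero (s : ℝ) (c : ℕ → Circle) (n : ℕ) :
    ∃ κ : ℂ, ‖κ‖ = Real.cosh s ^ n ∧ ∀ j,
      Complex.I * hermanProd s c n 0 0 j + hermanProd s c n 0 1 j = κ * ![Complex.I, 1] j := by
  induction n with
  | zero =>
    refine ⟨1, by simp, fun j => ?_⟩
    fin_cases j <;> simp [hermanProd, Matrix.one_apply]
  | succ n ih =>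
    obtain ⟨κ, hκ, h⟩ := ih
    refine ⟨-Complex.I * ((c n)⁻¹ : Circle) * (Real.cosh s : ℂ) * κ, ?_, fun j => ?_⟩
    · rw [norm_mul, norm_mul, norm_mul, hκ, Circle.norm_coe, Complex.norm_real, norm_neg,
        Complex.norm_I, Real.norm_of_nonneg (Real.cosh_pos s).le]
      ring
    · rw [mul_assoc, ← h j, Real.cosh_eq]
      simp only [hermanProd, Matrix.mul_apply, Fin.sum_univ_two, hermanFactor, Matrix.of_apply,
        Matrix.cons_val', Matrix.cons_val_zero, Matrix.cons_val_one, Matrix.cons_val_fin_one]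
      push_cast
      field_simp
      ring_nf
      simp only [Complex.I_pow_three, Complex.I_sq]
      ring

/-- The mean value inequality for the subharmonic function `log ‖f‖`. -/
lemma log_norm_zero_le_circleAverage {f : ℂ → ℂ} (hf : Differentiable ℂ f) (h0 : f 0 ≠ 0) :
    Real.log ‖f 0‖ ≤ Real.circleAverage (fun z => Real.log ‖f z‖) 0 1 := by
  have ha : AnalyticOnNhd ℂ f (Metric.closedBall 0 |1|) :=
    (Complex.analyticOnNhd_univ_iff_differentiable.2 hf).mono (Set.subset_univ _)
  rw [ha.circleAverage_log_norm one_ne_zero h0, le_add_iff_nonneg_left]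
  refine finsum_nonneg fun u => ?_
  by_cases hu : u ∈ Metric.closedBall (0 : ℂ) |1|
  · refine mul_nonneg (mod_cast MeromorphicOn.AnalyticOnNhd.divisor_nonneg ha u) ?_
    rcases eq_or_ne u 0 with rfl | hu0
    · simp
    · refine Real.log_nonneg ?_
      rw [one_mul, zero_sub, norm_neg]
      refine (one_le_inv₀ (norm_pos_iff.2 hu0)).2 ?_
      simpa using hu
  · rw [Function.locallyFinsuppWithin.apply_eq_zero_of_notMem _ hu]
    simp

lemma circleMap_eq_toCircle (θ : ℝ) :
    circleMap 0 1 θ = (AddCircle.toCircle ((((2 * Real.pi)⁻¹ * θ : ℝ)) : UnitAddCircle) : ℂ) := by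
  rw [AddCircle.toCircle_apply_mk, Circle.coe_exp, circleMap_zero]
  have : 2 * Real.pi / 1 * ((2 * Real.pi)⁻¹ * θ) = θ := by
    field_simp
  rw [this]
  simp

lemma integral_unitAddCircle_eq (g : UnitAddCircle → ℝ) :
    ∫ x, g x = (2 * Real.pi)⁻¹ *
      ∫ θ in (0 : ℝ)..2 * Real.pi, g (((2 * Real.pi)⁻¹ * θ : ℝ) : UnitAddCircle) := by
  rw [← UnitAddCircle.intervalIntegral_preimage 0 g]
  have h := intervalIntegral.integral_comp_mul_left (a := 0) (b := 2 * Real.pi)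
    (fun t : ℝ => g (t : UnitAddCircle)) (c := (2 * Real.pi)⁻¹) (by positivity)
  rw [h, smul_eq_mul, inv_inv, ← mul_assoc, inv_mul_cancel₀ (by positivity), one_mul, mul_zero,
    zero_add]

lemma continuous_cocycleIterate {X : Type*} [TopologicalSpace X] {T : X → X} (hT : Continuous T)
    {A : X → Matrix.SpecialLinearGroup (Fin 2) ℝ} (hA : Continuous A) (n : ℕ) :
    Continuous (cocycleIterate T A n) := by
  induction n with
  | zero => exact continuous_const
  | succ n ih => exact (hA.comp (hT.iterate n)).mul ih

lemma continuous_logGrowth {X : Type*} [TopologicalSpace X] {T : X → X} (hT : Continuous T)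
    {A : X → Matrix.SpecialLinearGroup (Fin 2) ℝ} (hA : Continuous A) (n : ℕ) :
    Continuous (logGrowth T A n) := by
  refine Continuous.log ?_ fun x => ?_
  · exact continuous_matrixOpNorm.comp
      (continuous_subtype_val.comp (continuous_cocycleIterate hT hA n))
  · have := one_le_matrixOpNorm (cocycleIterate T A n x)
    positivity

/-- **Herman's bound**, at finite time. -/
lemma le_integral_logGrowth_hermanCocycle (s a : ℝ) (n : ℕ) :
    n * Real.log (Real.cosh s) - Real.log 2 ≤
      ∫ x, logGrowth (· + (a : UnitAddCircle)) (hermanCocycle s) n x := by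
  set c : ℕ → Circle := fun n => AddCircle.toCircle (n • (a : UnitAddCircle)) with hc
  set f : ℂ → ℂ := fun z => Complex.I * hermanProd s c n z 0 1 + hermanProd s c n z 1 1 with hf
  set L := logGrowth (· + (a : UnitAddCircle)) (hermanCocycle s) n with hL
  have hLc : Continuous L := continuous_logGrowth (by fun_prop) (hermanCocycle s).continuous n
  have hdf : Differentiable ℂ f :=
    ((differentiable_hermanProd s c n 0 1).const_mul _).add (differentiable_hermanProd s c n 1 1)
  have hf0 : ‖f 0‖ = Real.cosh s ^ n := by
    obtain ⟨κ, hκ, h⟩ := norm_vecMul_hermanProd_zero s c n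
    have h1 := h 1
    simp only [Matrix.cons_val_one, Matrix.cons_val_fin_one, mul_one] at h1
    rw [hf]
    simp only [h1, hκ]
  have hf0' : f 0 ≠ 0 := by
    rw [← norm_pos_iff, hf0]
    exact pow_pos (Real.cosh_pos s) n
  have hJ := log_norm_zero_le_circleAverage hdf hf0'
  rw [hf0, Real.log_pow] at hJ
  have hpt : ∀ x : UnitAddCircle, Real.log ‖f (AddCircle.toCircle x)‖ ≤ Real.log 2 + L x := by
    intro x
    have h1 := one_le_matrixOpNorm (cocycleIterate (· + (a : UnitAddCircle)) (hermanCocycle s) n x)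
    have hle : ‖f (AddCircle.toCircle x)‖ ≤ 2 *
        matrixOpNorm (cocycleIterate (· + (a : UnitAddCircle)) (hermanCocycle s) n x).1 := by
      simp only [hf, hc, hermanProd_toCircle]
      refine (norm_add_le _ _).trans ?_
      simp only [Matrix.smul_apply, Matrix.map_apply, norm_mul, Complex.norm_I, one_mul,
        smul_eq_mul, norm_pow, Circle.norm_coe, one_pow, Complex.norm_real, Real.norm_eq_abs]
      have h2 := abs_entry_le_matrixOpNorm
        (cocycleIterate (· + (a : UnitAddCircle)) (hermanCocycle s) n x).1 0 1
      have h3 := abs_entry_le_matrixOpNorm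
        (cocycleIterate (· + (a : UnitAddCircle)) (hermanCocycle s) n x).1 1 1
      linarith
    rcases eq_or_ne (f (AddCircle.toCircle x)) 0 with h0 | h0
    · -- At a zero of `f` the junk value `Real.log 0 = 0` satisfies the bound as well.
      rw [h0, norm_zero, Real.log_zero]
      exact add_nonneg (Real.log_nonneg one_le_two) (logGrowth_nonneg _ _ _ _)
    · rw [hL, logGrowth, ← Real.log_mul two_ne_zero (by positivity)]
      exact Real.log_le_log (norm_pos_iff.2 h0) hle
  have hint : CircleIntegrable (fun z => Real.log ‖f z‖) 0 1 :=
    MeromorphicOn.circleIntegrable_log_norm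
      (((Complex.analyticOnNhd_univ_iff_differentiable.2 hdf).mono
        (Set.subset_univ _)).meromorphicOn)
  have hmono : Real.circleAverage (fun z => Real.log ‖f z‖) 0 1 ≤ ∫ x, (Real.log 2 + L x) := by
    rw [Real.circleAverage_def, integral_unitAddCircle_eq, smul_eq_mul]
    gcongr
    refine intervalIntegral.integral_mono_on (by positivity) hint ?_ fun θ _ => ?_
    · refine Continuous.intervalIntegrable ?_ _ _
      exact continuous_const.add (hLc.comp ((AddCircle.continuous_mk' 1).comp (by fun_prop)))
    · simp only [circleMap_eq_toCircle]
      exact hpt _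
  rw [integral_add (integrable_const _)
    (hLc.integrable_of_hasCompactSupport (HasCompactSupport.of_compactSpace _))] at hmono
  simp only [integral_const, measureReal_def, UnitAddCircle.measure_univ, ENNReal.toReal_one,
    one_smul] at hmono
  linarith

lemma measurable_upperLyapunovExponent {X : Type*} [TopologicalSpace X] [MeasurableSpace X]
    [BorelSpace X] {T : X → X} (hT : Continuous T)
    {A : X → Matrix.SpecialLinearGroup (Fin 2) ℝ} (hA : Continuous A) :
    Measurable (upperLyapunovExponent T A) :=
  Measurable.limsup fun n => ((continuous_logGrowth hT hA n).measurable).const_mul _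

/-- The reverse Fatou lemma carries lower bounds for the mean growth over to the integrated
exponent. -/
lemma le_integral_upperLyapunovExponent {X : Type*} [TopologicalSpace X] [MeasurableSpace X]
    [BorelSpace X] (μ : Measure X) [IsProbabilityMeasure μ] {T : X → X} (hT : Continuous T)
    {A : X → Matrix.SpecialLinearGroup (Fin 2) ℝ} (hA : Continuous A) {Λ c : ℝ}
    (hΛ : ∀ x, Real.log (matrixOpNorm (A x).1) ≤ Λ) {e : ℕ → ℝ} (he : Tendsto e atTop (𝓝 c))
    (h : ∀ n, 0 < n → e n ≤ ∫ x, (1 / (n : ℝ)) * logGrowth T A n x ∂μ) :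
    c ≤ ∫ x, upperLyapunovExponent T A x ∂μ := by
  set g : ℕ → X → ℝ := fun n x => (1 / (n : ℝ)) * logGrowth T A n x with hg
  have hg0 : ∀ n x, 0 ≤ g n x := fun n x => one_div_mul_logGrowth_nonneg T A n x
  have hgΛ : ∀ n x, g n x ≤ Λ := fun n x => one_div_mul_logGrowth_le T A hΛ n x
  have hgm : ∀ n, Measurable (g n) := fun n =>
    ((continuous_logGrowth hT hA n).measurable).const_mul _
  have hbdd : ∀ x, IsBoundedUnder (· ≤ ·) atTop fun n => g n x :=
    fun x => isBoundedUnder_of ⟨Λ, fun n => hgΛ n x⟩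
  have hlim : ∀ x, ENNReal.ofReal (upperLyapunovExponent T A x) =
      limsup (fun n => ENNReal.ofReal (g n x)) atTop := fun x =>
    ENNReal.ofReal_mono.map_limsup_of_continuousAt (a := fun n => g n x) (F := atTop)
      ENNReal.continuous_ofReal.continuousAt (hbdd x)
      (isCoboundedUnder_le_of_le atTop fun n => hg0 n x)
  have hfatou := limsup_lintegral_le (μ := μ) (f := fun n x => ENNReal.ofReal (g n x))
    (fun _ => ENNReal.ofReal Λ) (fun n => (hgm n).ennreal_ofReal)
    (fun n => ae_of_all _ fun x => ENNReal.ofReal_le_ofReal (hgΛ n x)) (by simp)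
  simp only [← hlim] at hfatou
  have h1 : ENNReal.ofReal c ≤ ∫⁻ x, ENNReal.ofReal (upperLyapunovExponent T A x) ∂μ := by
    refine le_trans ?_ hfatou
    have h2 : Tendsto (fun n => ENNReal.ofReal (e n)) atTop (𝓝 (ENNReal.ofReal c)) :=
      (ENNReal.continuous_ofReal.tendsto c).comp he
    rw [← h2.limsup_eq]
    refine limsup_le_limsup ?_
    filter_upwards [eventually_gt_atTop 0] with n hn
    have hi : Integrable (g n) μ := Integrable.of_bound (hgm n).aestronglyMeasurable Λ
      (ae_of_all _ fun x => by rw [Real.norm_of_nonneg (hg0 n x)]; exact hgΛ n x)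
    rw [← ofReal_integral_eq_lintegral_ofReal hi (ae_of_all _ (hg0 n))]
    exact ENNReal.ofReal_le_ofReal (h n hn)
  have hup0 : ∀ x, 0 ≤ upperLyapunovExponent T A x := upperLyapunovExponent_nonneg T A hΛ
  have hupΛ : ∀ x, upperLyapunovExponent T A x ≤ Λ := fun x =>
    upperLyapunovExponent_le_of_tendsto T A (fun n _ => hgΛ n x) tendsto_const_nhds
  have hi : Integrable (upperLyapunovExponent T A) μ :=
    Integrable.of_bound (measurable_upperLyapunovExponent hT hA).aestronglyMeasurable Λ
      (ae_of_all _ fun x => by rw [Real.norm_of_nonneg (hup0 x)]; exact hupΛ x)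
  rw [← ofReal_integral_eq_lintegral_ofReal hi (ae_of_all _ hup0)] at h1
  exact (ENNReal.ofReal_le_ofReal_iff (integral_nonneg hup0)).1 h1

instance : IsProbabilityMeasure (volume : Measure UnitAddCircle) :=
  ⟨UnitAddCircle.measure_univ⟩

/-- **Herman's bound.** -/
theorem sub_log_two_le_integratedLyapunovExponent {s : ℝ} (hs : 0 ≤ s) (a : ℝ) :
    s - Real.log 2 ≤ integratedLyapunovExponent (· + (a : UnitAddCircle)) volume
      (hermanCocycle s) := by
  have hcosh : s - Real.log 2 ≤ Real.log (Real.cosh s) := by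
    rw [← Real.log_exp s, ← Real.log_div (Real.exp_pos _).ne' two_ne_zero, Real.log_exp]
    refine Real.log_le_log (by positivity) ?_
    rw [Real.cosh_eq]
    have := Real.exp_pos (-s)
    linarith
  refine hcosh.trans ?_
  have he : Tendsto (fun n : ℕ => Real.log (Real.cosh s) - (n : ℝ)⁻¹ * Real.log 2) atTop
      (𝓝 (Real.log (Real.cosh s))) := by
    simpa using tendsto_const_nhds.sub (tendsto_inv_atTop_nhds_zero_nat.mul_const (Real.log 2))
  refine le_integral_upperLyapunovExponent volume (by fun_prop) (hermanCocycle s).continuous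
    (fun x => log_matrixOpNorm_hermanMatrix_le hs _) he fun n hn => ?_
  have hn' : (0 : ℝ) < n := by exact_mod_cast hn
  rw [integral_const_mul, one_div, le_inv_mul_iff₀ hn', mul_sub, ← mul_assoc,
    mul_inv_cancel₀ hn'.ne', one_mul]
  exact le_integral_logGrowth_hermanCocycle s a n

/-! ### Collapsing the circle along a symmetric orbit segment -/

/-- Along an orbit segment that is symmetric about `0` the expansion of the first half is undone by
the second half: with `D = diag (exp s, exp (-s))` and `J` the rotation by a right angle, the
identity `D * J * D = J` cancels the factors in pairs, from the middle outwards. -/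
lemma cocycleIterate_hermanMatrix_symmetric (s a : ℝ) (φ : UnitAddCircle → UnitAddCircle) (K : ℕ)
    (x : UnitAddCircle)
    (h : ∀ j ≤ 2 * K, φ (x + j • (a : UnitAddCircle)) =
      j • (a : UnitAddCircle) - K • (a : UnitAddCircle)) :
    ∃ ε : ℝ, ε ^ 2 = 1 ∧
      (cocycleIterate (· + (a : UnitAddCircle)) (fun y => hermanMatrix s (AddCircle.toCircle (φ y)))
        (2 * K + 1) x).1 = ε • !![0, -Real.exp s; Real.exp (-s), 0] := by
  induction K generalizing x with
  | zero =>
    refine ⟨1, by norm_num, ?_⟩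
    have h0 := h 0 le_rfl
    simp only [zero_smul, add_zero, sub_zero] at h0
    simp only [cocycleIterate, Function.iterate_zero, id, h0, mul_one]
    simp [hermanMatrix]
  | succ K ih =>
    obtain ⟨ε, hε, hM⟩ := ih (x + a) fun j hj => by
      have := h (j + 1) (by omega)
      rw [add_assoc, ← succ_nsmul', this, succ_nsmul, succ_nsmul]
      abel
    refine ⟨-ε, by rw [neg_sq, hε], ?_⟩
    set z := AddCircle.toCircle ((K + 1) • (a : UnitAddCircle)) with hz
    have hfirst : φ x = -((K + 1) • (a : UnitAddCircle)) := by
      simpa using h 0 (Nat.zero_le _)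
    have hlast : φ (x + (2 * K + 1 + 1) • (a : UnitAddCircle)) = (K + 1) • (a : UnitAddCircle) := by
      rw [h _ (by omega), ← sub_eq_zero, sub_sub, ← add_nsmul, sub_eq_zero]
      congr 1
      omega
    rw [show 2 * (K + 1) + 1 = 1 + ((2 * K + 1) + 1) by ring, cocycleIterate_add,
      cocycleIterate_add]
    simp only [Matrix.SpecialLinearGroup.coe_mul, Function.iterate_one, hM]
    simp only [cocycleIterate, iterate_add_right_apply, mul_one, hlast,
      hfirst, ← hz, AddCircle.toCircle_neg, zero_smul, add_zero]
    have h1 := re_sq_add_im_sq z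
    have h2 : Real.exp s * Real.exp (-s) = 1 := by rw [← Real.exp_add]; simp
    simp only [hermanMatrix, Circle.coe_inv_eq_conj, Complex.conj_re, Complex.conj_im]
    set p := (z : ℂ).re
    set q := (z : ℂ).im
    set l := Real.exp s
    set m := Real.exp (-s)
    ext i j
    fin_cases i <;> fin_cases j <;> simp [Matrix.mul_apply, Fin.sum_univ_two]
    · ring
    · linear_combination (ε * l * (q ^ 2 + p ^ 2)) * h2 + ε * l * h1
    · linear_combination (-ε * m * (q ^ 2 + p ^ 2)) * h2 - ε * m * h1
    · ring

lemma logGrowth_hermanMatrix_symmetric_le {s : ℝ} (hs : 0 ≤ s) (a : ℝ)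
    (φ : UnitAddCircle → UnitAddCircle) (K : ℕ) (x : UnitAddCircle)
    (h : ∀ j ≤ 2 * K, φ (x + j • (a : UnitAddCircle)) =
      j • (a : UnitAddCircle) - K • (a : UnitAddCircle)) :
    logGrowth (· + (a : UnitAddCircle)) (fun y => hermanMatrix s (AddCircle.toCircle (φ y)))
        (2 * K + 1) x ≤ s := by
  obtain ⟨ε, hε, hM⟩ := cocycleIterate_hermanMatrix_symmetric s a φ K x h
  have h1 := one_le_matrixOpNorm (cocycleIterate (· + (a : UnitAddCircle))
    (fun y => hermanMatrix s (AddCircle.toCircle (φ y))) (2 * K + 1) x)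
  rw [logGrowth, Real.log_le_iff_le_exp (by positivity), hM]
  refine matrixOpNorm_le (Real.exp_pos s).le fun u v => ?_
  have h2 : Real.exp (-s) ^ 2 ≤ Real.exp s ^ 2 :=
    pow_le_pow_left₀ (Real.exp_pos _).le (Real.exp_le_exp.2 (by linarith)) 2
  simp
  ring_nf
  rw [hε]
  nlinarith [mul_le_mul_of_nonneg_right h2 (sq_nonneg u)]

/-- The continuous bump on the circle that is `1` on the ball of radius `r` about `0` and vanishes
off the ball of radius `2 * r`. -/
noncomputable def bump (r : ℝ) (y : UnitAddCircle) : ℝ := max 0 (min 1 (2 - ‖y‖ / r))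

lemma continuous_bump (r : ℝ) : Continuous (bump r) := by
  unfold bump
  fun_prop

lemma bump_nonneg (r : ℝ) (y : UnitAddCircle) : 0 ≤ bump r y := le_max_left _ _

lemma bump_le_one (r : ℝ) (y : UnitAddCircle) : bump r y ≤ 1 :=
  max_le zero_le_one (min_le_left _ _)

lemma bump_eq_one {r : ℝ} (hr : 0 < r) {y : UnitAddCircle} (hy : ‖y‖ ≤ r) : bump r y = 1 := by
  have : ‖y‖ / r ≤ 1 := (div_le_one hr).2 hy
  rw [bump, min_eq_left (by linarith), max_eq_right zero_le_one]

lemma bump_eq_zero {r : ℝ} (hr : 0 < r) {y : UnitAddCircle} (hy : 2 * r ≤ ‖y‖) :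
    bump r y = 0 := by
  have : 2 ≤ ‖y‖ / r := (le_div_iff₀ hr).2 hy
  exact max_eq_left ((min_le_right _ _).trans (by linarith))

/-- A continuous function on the circle that agrees with the signed coordinate in `[-1/4, 1/4]`
near `0`; it is the distance from `-1/4`, shifted. -/
noncomputable def signedCoord (y : UnitAddCircle) : ℝ := ‖y + ((1 / 4 : ℝ) : UnitAddCircle)‖ - 1 / 4

lemma continuous_signedCoord : Continuous signedCoord := by
  unfold signedCoord
  fun_prop

lemma coe_signedCoord {y : UnitAddCircle} (hy : ‖y‖ ≤ 1 / 4) :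
    ((signedCoord y : ℝ) : UnitAddCircle) = y ∧ |signedCoord y| = ‖y‖ := by
  obtain ⟨t, rfl, ht⟩ : ∃ t : ℝ, (t : UnitAddCircle) = y ∧ |t| = ‖y‖ := by
    induction y using QuotientAddGroup.induction_on with
    | H u =>
      refine ⟨u - round u, ?_, (UnitAddCircle.norm_eq).symm⟩
      rw [AddCircle.coe_sub, sub_eq_self, AddCircle.coe_eq_zero_iff]
      exact ⟨round u, by simp⟩
  rw [← ht, abs_le] at hy
  have h : signedCoord t = t := by
    rw [signedCoord, ← AddCircle.coe_add, (AddCircle.norm_coe_eq_abs_iff 1 one_ne_zero).2,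
      abs_of_nonneg (by linarith)]
    · ring
    · rw [abs_of_nonneg (by linarith), abs_one]
      linarith
  rw [h]
  exact ⟨rfl, ht⟩

/-- The displacement that moves each small ball about a point `j • a - K • a`, `j ≤ 2 * K`, to its
centre. -/
noncomputable def collapseShift (a : UnitAddCircle) (K : ℕ) (r : ℝ) (y : UnitAddCircle) : ℝ :=
  ∑ j ∈ Finset.range (2 * K + 1),
    bump r (y - (j • a - K • a)) * signedCoord (y - (j • a - K • a))

/-- The self-map of the circle that is constant on each ball of radius `r` about a point
`j • a - K • a`, `j ≤ 2 * K`, and the identity off the balls of radius `2 * r`, provided that `r`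
is small and these points are `4 * r`-separated. -/
noncomputable def collapse (a : UnitAddCircle) (K : ℕ) (r : ℝ) :
    C(UnitAddCircle, UnitAddCircle) where
  toFun y := y - (collapseShift a K r y : UnitAddCircle)
  continuous_toFun := by
    refine continuous_id.sub ((AddCircle.continuous_mk' 1).comp ?_)
    refine continuous_finsetSum _ fun j _ => ?_
    exact ((continuous_bump r).comp (by fun_prop)).mul (continuous_signedCoord.comp (by fun_prop))

section Collapse

variable {a : UnitAddCircle} {K : ℕ} {r : ℝ}

lemma le_norm_sub_nsmul (hsep : ∀ j : ℕ, 0 < j → j < 2 * K + 1 → 4 * r ≤ ‖j • a‖)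
    {i j : ℕ} (hi : i < 2 * K + 1) (hj : j < 2 * K + 1) (hij : i ≠ j) :
    4 * r ≤ ‖i • a - j • a‖ := by
  wlog hlt : j < i generalizing i j
  · rw [norm_sub_rev]
    exact this hj hi hij.symm (by omega)
  · rw [sub_eq_add_neg, ← sub_nsmul _ hlt.le]
    exact hsep _ (by omega) (by omega)

lemma collapseShift_eq (hr : 0 < r) (hsep : ∀ j : ℕ, 0 < j → j < 2 * K + 1 → 4 * r ≤ ‖j • a‖)
    {j : ℕ} (hj : j < 2 * K + 1) {y : UnitAddCircle} (hy : ‖y - (j • a - K • a)‖ ≤ 2 * r) :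
    collapseShift a K r y =
      bump r (y - (j • a - K • a)) * signedCoord (y - (j • a - K • a)) := by
  refine Finset.sum_eq_single_of_mem j (Finset.mem_range.2 hj) fun i hi hij => ?_
  have h1 := le_norm_sub_nsmul hsep (Finset.mem_range.1 hi) hj hij
  have h2 : i • a - j • a = (y - (j • a - K • a)) - (y - (i • a - K • a)) := by abel
  rw [h2] at h1
  have h3 := h1.trans (norm_sub_le _ _)
  rw [bump_eq_zero hr (by linarith), zero_mul]

lemma collapse_eq (hr : 0 < r) (hr4 : r ≤ 1 / 4)
    (hsep : ∀ j : ℕ, 0 < j → j < 2 * K + 1 → 4 * r ≤ ‖j • a‖)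
    {j : ℕ} (hj : j < 2 * K + 1) {y : UnitAddCircle} (hy : ‖y - (j • a - K • a)‖ ≤ r) :
    collapse a K r y = j • a - K • a := by
  change y - (collapseShift a K r y : UnitAddCircle) = _
  rw [collapseShift_eq hr hsep hj (by linarith), bump_eq_one hr hy, one_mul,
    (coe_signedCoord (hy.trans hr4)).1]
  abel

lemma dist_collapse_le (hr : 0 < r) (hr8 : r ≤ 1 / 8)
    (hsep : ∀ j : ℕ, 0 < j → j < 2 * K + 1 → 4 * r ≤ ‖j • a‖) (y : UnitAddCircle) :
    dist (collapse a K r y) y ≤ 2 * r := by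
  have hshift : |collapseShift a K r y| ≤ 2 * r := by
    by_cases h : ∃ j < 2 * K + 1, ‖y - (j • a - K • a)‖ ≤ 2 * r
    · obtain ⟨j, hj, hy⟩ := h
      rw [collapseShift_eq hr hsep hj hy, abs_mul, (coe_signedCoord (by linarith)).2,
        abs_of_nonneg (bump_nonneg _ _)]
      exact (mul_le_of_le_one_left (norm_nonneg _) (bump_le_one _ _)).trans hy
    · push Not at h
      rw [collapseShift, Finset.sum_eq_zero, abs_zero]
      · positivity
      · intro j hj
        rw [bump_eq_zero hr (h j (Finset.mem_range.1 hj)).le, zero_mul]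
  rw [dist_eq_norm]
  change ‖y - (collapseShift a K r y : UnitAddCircle) - y‖ ≤ _
  rw [sub_sub_cancel_left, norm_neg, UnitAddCircle.norm_eq]
  exact (round_le (collapseShift a K r y) 0).trans (by simpa using hshift)

lemma bump_visit_disjoint (hr : 0 < r)
    (hsep : ∀ j : ℕ, 0 < j → j < 2 * K + 1 → 4 * r ≤ ‖j • a‖) {y : UnitAddCircle}
    (hy : bump (r / 2) (y + K • a) ≠ 0) {i : ℕ} (h0 : 0 < i) (hi : i < 2 * K + 1) :
    bump (r / 2) (y + i • a + K • a) = 0 := by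
  have h1 : ‖y + K • a‖ < r := by
    by_contra! h
    exact hy (bump_eq_zero (by positivity) (by linarith))
  have h2 := hsep i h0 hi
  have h3 : i • a = (y + i • a + K • a) - (y + K • a) := by abel
  rw [h3] at h2
  have h4 := h2.trans (norm_sub_le _ _)
  exact bump_eq_zero (by positivity) (by linarith)

end Collapse

lemma le_integral_bump {r : ℝ} (hr : 0 < r) (hr1 : r ≤ 1) (b : UnitAddCircle) :
    r ≤ ∫ y : UnitAddCircle, bump (r / 2) (y + b) := by
  have h1 : ∫ y : UnitAddCircle, bump (r / 2) (y + b) = ∫ y : UnitAddCircle, bump (r / 2) y :=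
    integral_add_right_eq_self _ b
  have h2 : ∫ y in Metric.closedBall (0 : UnitAddCircle) (r / 2), bump (r / 2) y = r := by
    rw [setIntegral_congr_fun (g := fun _ => (1 : ℝ)) measurableSet_closedBall]
    · rw [setIntegral_const, measureReal_def, AddCircle.volume_closedBall, smul_eq_mul, mul_one,
        mul_div_cancel₀ _ two_ne_zero, min_eq_right hr1, ENNReal.toReal_ofReal hr.le]
    · intro y hy
      exact bump_eq_one (by positivity) (by simpa using hy)
  rw [h1]
  refine h2.symm.le.trans (setIntegral_le_integral ?_ (ae_of_all _ (bump_nonneg _)))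
  exact (continuous_bump _).integrable_of_hasCompactSupport (HasCompactSupport.of_compactSpace _)

/-- Collapsing the balls about a symmetric orbit segment lowers the exponent by the proportion of
time that orbits spend in the collapsed tower. -/
lemma integratedLyapunovExponent_collapse_le {s : ℝ} (hs : 0 ≤ s) {a : ℝ} (ha : Irrational a)
    {K : ℕ} {r : ℝ} (hr : 0 < r) (hr4 : r ≤ 1 / 4)
    (hsep : ∀ j : ℕ, 0 < j → j < 2 * K + 1 → 4 * r ≤ ‖j • (a : UnitAddCircle)‖) :
    integratedLyapunovExponent (· + (a : UnitAddCircle)) volume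
      ((hermanCocycle s).comp (collapse a K r)) ≤ s * (1 - 2 * K * r) := by
  set T : UnitAddCircle → UnitAddCircle := (· + (a : UnitAddCircle)) with hT
  set φ := collapse a K r
  set f : C(UnitAddCircle, ℝ) := ⟨fun y => bump (r / 2) (y + K • (a : UnitAddCircle)),
    (continuous_bump _).comp (by fun_prop)⟩ with hf
  have hΛ : ∀ x, Real.log (matrixOpNorm ((hermanCocycle s).comp φ x).1) ≤ s :=
    fun x => log_matrixOpNorm_hermanMatrix_le hs _
  have hgrowth := logGrowth_le_sub_visits T ((hermanCocycle s).comp φ) hΛ (f := f)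
    (fun y => bump_le_one _ _) (Nat.succ_pos (2 * K))
    (fun y hy i h0 hi => by
      rw [hT, iterate_add_right_apply]
      exact bump_visit_disjoint hr hsep hy h0 hi)
    (fun y hy => by
      refine logGrowth_hermanMatrix_symmetric_le hs a φ K y fun j hj => ?_
      refine collapse_eq hr hr4 hsep (by omega) ?_
      have h1 : y + j • (a : UnitAddCircle) - (j • (a : UnitAddCircle) - K • (a : UnitAddCircle))
        = y + K • (a : UnitAddCircle) := by abel
      rw [h1]
      by_contra! h
      exact hy (bump_eq_zero (by positivity) (by linarith)))
  have hpt : ∀ x, upperLyapunovExponent T ((hermanCocycle s).comp φ) x ≤ s * (1 - 2 * K * r) := by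
    intro x
    have hw := tendsto_real_average_of_irrational ha f x
    have hu : Tendsto (fun n : ℕ => s * (1 + (2 * K + 1) * (n : ℝ)⁻¹ - 2 * K *
        ((1 / (n : ℝ)) * ∑ i ∈ Finset.range n, f (x + i • (a : UnitAddCircle))))) atTop
        (𝓝 (s * (1 + (2 * K + 1) * 0 - 2 * K * ∫ y, f y))) :=
      ((tendsto_const_nhds.add (tendsto_inv_atTop_nhds_zero_nat.const_mul _)).sub
        (hw.const_mul _)).const_mul _
    refine (upperLyapunovExponent_le_of_tendsto _ _ (fun n hn => ?_) hu).trans ?_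
    · have hn' : (0 : ℝ) < n := by exact_mod_cast hn
      have h := hgrowth n x
      simp only [hT, iterate_add_right_apply] at h
      rw [one_div, inv_mul_le_iff₀ hn']
      refine h.trans (le_of_eq ?_)
      push_cast
      field_simp
      ring
    · have hfi : r ≤ ∫ y, f y := le_integral_bump hr (by linarith) _
      rw [mul_zero, add_zero]
      gcongr
  refine (integral_mono_of_nonneg
    (ae_of_all _ (upperLyapunovExponent_nonneg T _ hΛ)) (integrable_const _)
    (ae_of_all _ hpt)).trans ?_
  simp [measureReal_def]

/-- Arbitrarily close to the identity there are self-maps of the circle that push the exponent of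
Herman's cocycle below a fixed proportion of its maximal value. -/
lemma exists_dist_le_and_integratedLyapunovExponent_le {s : ℝ} (hs : 0 ≤ s) {a : ℝ}
    (ha : Irrational a) {δ : ℝ} (hδ : 0 < δ) :
    ∃ φ : C(UnitAddCircle, UnitAddCircle), (∀ y, dist (φ y) y ≤ δ) ∧
      integratedLyapunovExponent (· + (a : UnitAddCircle)) volume ((hermanCocycle s).comp φ)
        ≤ s * (15 / 16) := by
  obtain ⟨M, hM⟩ := exists_nat_one_div_lt hδ
  obtain ⟨H, hH, hsep⟩ := exists_forall_one_div_two_mul_le_norm_nsmul ha (M + 4)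
  obtain ⟨K, hK1, hK2⟩ : ∃ K : ℕ, 2 * K + 1 ≤ H ∧ H ≤ 2 * K + 2 := ⟨(H - 1) / 2, by omega, by omega⟩
  have hH4 : (4 : ℝ) ≤ H := by exact_mod_cast (by omega : 4 ≤ H)
  have hMH : (M + 1 : ℝ) ≤ H := by exact_mod_cast (by omega : M + 1 ≤ H)
  have hK2' : (H : ℝ) ≤ 2 * K + 2 := by exact_mod_cast hK2
  -- A quarter of the separation; the saving `2 * K * r` is then at least
  -- `(H - 2) / (8 * H) ≥ 1 / 16`.
  set r : ℝ := 1 / (8 * H) with hr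
  have hr0 : 0 < r := by positivity
  have hrH : r * H = 1 / 8 := by rw [hr]; field_simp
  have hr8 : r ≤ 1 / 8 := by nlinarith
  have hsep' : ∀ j : ℕ, 0 < j → j < 2 * K + 1 → 4 * r ≤ ‖j • (a : UnitAddCircle)‖ := by
    intro j h0 hj
    refine le_trans (le_of_eq ?_) (hsep j h0 (by omega))
    rw [hr]
    field_simp
    norm_num
  refine ⟨collapse a K r, fun y => (dist_collapse_le hr0 hr8 hsep' y).trans ?_, ?_⟩
  · refine le_trans ?_ hM.le
    rw [le_div_iff₀ (by positivity)]
    nlinarith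
  · refine (integratedLyapunovExponent_collapse_le hs ha hr0 (by linarith) hsep').trans ?_
    gcongr
    nlinarith

/-! ### Reduction to the circle -/

lemma upperLyapunovExponent_semiconj {X Y : Type*} {T : X → X} {S : Y → Y} {π : X → Y}
    (h : Function.Semiconj π T S) (A : Y → Matrix.SpecialLinearGroup (Fin 2) ℝ) (x : X) :
    upperLyapunovExponent T (A ∘ π) x = upperLyapunovExponent S A (π x) := by
  have hc : ∀ n, cocycleIterate T (A ∘ π) n x = cocycleIterate S A n (π x) := by
    intro n
    induction n with
    | zero => rfl
    | succ n ih => simp only [cocycleIterate, ih, Function.comp, (h.iterate_right n).eq]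
  simp only [upperLyapunovExponent, hc]

lemma integratedLyapunovExponent_comp {X Y : Type*} [TopologicalSpace X] [MeasurableSpace X]
    [TopologicalSpace Y] [MeasurableSpace Y] [BorelSpace Y] {μ : Measure X} {ν : Measure Y}
    {T : X → X} {S : Y → Y} (hS : Continuous S) {π : C(X, Y)} (hπ : MeasurePreserving π μ ν)
    (h : Function.Semiconj π T S) (A : C(Y, Matrix.SpecialLinearGroup (Fin 2) ℝ)) :
    integratedLyapunovExponent T μ (A.comp π) = integratedLyapunovExponent S ν A := by
  unfold integratedLyapunovExponent
  rw [← hπ.map_eq, integral_map hπ.measurable.aemeasurable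
    (measurable_upperLyapunovExponent hS A.continuous).aestronglyMeasurable]
  exact integral_congr_ae (ae_of_all _ fun x => upperLyapunovExponent_semiconj h A x)

end LyapunovRotation

open LyapunovRotation

theorem mainTheorem8 (n : ℕ) (α : Fin n → ℝ) (hα : IsIrrationalVector α) :
    ¬ Continuous (integratedLyapunovExponent (torusRotation α)
      (volume : Measure (UnitAddTorus (Fin n)))) := by
  intro hcont
  obtain ⟨i, hi⟩ := hα
  -- Cocycles that depend on the `i`-th coordinate only reduce the problem to the circle.
  set π : C(UnitAddTorus (Fin n), UnitAddCircle) := ⟨fun x => x i, continuous_apply i⟩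
  have hπ : MeasurePreserving π (volume : Measure (UnitAddTorus (Fin n))) volume :=
    measurePreserving_eval (fun _ : Fin n => (volume : Measure UnitAddCircle)) i
  have hsemi : Function.Semiconj π (torusRotation α) (· + (α i : UnitAddCircle)) := fun x => rfl
  have hcircle : Continuous (integratedLyapunovExponent (· + (α i : UnitAddCircle))
      (volume : Measure UnitAddCircle)) := by
    refine (hcont.comp (ContinuousMap.continuous_precomp π)).congr fun A => ?_
    exact integratedLyapunovExponent_comp (by fun_prop) hπ hsemi A
  -- With `s = 16`, Herman's bound `s - log 2` exceeds the bound `15 / 16 * s` after collapsing.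
  choose φ hφ hle using fun k : ℕ => exists_dist_le_and_integratedLyapunovExponent_le
    (s := 16) (by norm_num) hi (Nat.one_div_pos_of_nat (α := ℝ) (n := k))
  have hlim : Tendsto φ atTop (𝓝 (ContinuousMap.id UnitAddCircle)) := by
    rw [tendsto_iff_dist_tendsto_zero]
    refine squeeze_zero (fun _ => dist_nonneg) (fun k => ?_)
      (tendsto_one_div_add_atTop_nhds_zero_nat (𝕜 := ℝ))
    exact (ContinuousMap.dist_le (Nat.one_div_pos_of_nat (α := ℝ)).le).2 (hφ k)
  have hlim2 := (hcircle.tendsto _).comp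
    (((ContinuousMap.continuous_postcomp (hermanCocycle 16)).tendsto _).comp hlim)
  have hbound := le_of_tendsto' hlim2 hle
  rw [ContinuousMap.comp_id] at hbound
  have hherman := sub_log_two_le_integratedLyapunovExponent (s := 16) (by norm_num) (α i)
  have := Real.log_two_lt_d9
  linarith
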